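/- Consider a single-server retrial queue with two infinite-capacity orbit queues, arrival rate $\lambda>0$, service rate $\mu>0$, retrial rate $\alpha>0$ from each non-empty orbit, in which a blocked job joins the shorter orbit queue. Put $\rho=\frac{\lambda(\lambda+2\alpha)}{2\alpha\mu}$ and $$A=\begin{pmatrix}0&0\\0&\lambda\end{pmatrix},\quad R=\begin{pmatrix}0&0\\\alpha&0\end{pmatrix},\quad C=\begin{pmatrix}-\lambda&\mu\\\lambda&-(\lambda+\mu)\end{pmatrix}-2\begin{pmatrix}\alpha&0\\0&0\end{pmatrix}.$$ For vectors $\mathbf q(m,n)=(q_{m,n}(0),q_{m,n}(1))^T\in\mathbb R^2$, $m,n\ge 0$ ($m$ is the length of the shorter orbit queue, $n$ the difference of the two lengths, and $0,1$ stand for an idle or busy server), the equilibrium equations on the horizontal boundary and in the interior are $$C\mathbf q(m,0)+R\,\mathbf q(m,1)+A\,\mathbf q(m-1,1)=\mathbf 0,\qquad m\ge 1,$$ $$C\mathbf q(m,1)+R\,\mathbf q(m,2)+2R\,\mathbf q(m+1,0)+A\,\mathbf q(m-1,2)+A\,\mathbf q(m,0)=\mathbf 0,\qquad m\ge1,$$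 $$C\mathbf q(m,n)+R\,\mathbf q(m,n+1)+A\,\mathbf q(m-1,n+1)+R\,\mathbf q(m+1,n-1)=\mathbf 0,\qquad m\ge1,\ n\ge2.$$ Suppose $\rho<1$. Then these equations have, up to a multiplicative constant, a unique solution of the form $$\mathbf q(m,n)=\rho^{2m}\mathbf u(n),\qquad m>0,\ n\ge0,$$ where $\mathbf u=(\mathbf u(n))_{n\ge0}$, $\mathbf u(n)=(u_0(n),u_1(n))^T\in\mathbb R^2$, is not identically zero and $\sum_{n=0}^\infty\rho^{-2n}u_k(n)$ converges absolutely for $k=0,1$. That is, there is such a solution $(\mathbf q,\mathbf u)$, which can moreover be chosen with $\mathbf u(n)\ne\mathbf 0$ for every $n\ge0$ and with $\mathbf q(0,n)=\mathbf u(n)$ for all $n\geq 0$; and for every other such solution $(\mathbf q',\mathbf u')$ there is a constant $c\neq0$ with $\mathbf u'(n)=c\,\mathbf u(n)$ for all $n\ge0$ and $\mathbf q'(m,n)=c\,\mathbf q(m,n)$ for all $m>0$, $n\ge0$. -/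

import Mathlib

open scoped Matrix

/-- The load `ρ = λ(λ + 2α) / (2αμ)` of the queue with arrival rate `lam`, service rate `mu` and
retrial rate `al` of each of the two orbit queues. -/
noncomputable def JSQ.rho (lam mu al : ℝ) : ℝ := lam * (lam + 2 * al) / (2 * al * mu)

/-- `A_{1,-1} = A_{0,1}`: an arriving job finds the server busy and joins the shorter orbit. -/
def JSQ.matArr (lam : ℝ) : Matrix (Fin 2) (Fin 2) ℝ := !![0, 0; 0, lam]

/-- `A_{0,-1} = A_{-1,1}`: a retrial from one orbit finds the server idle. -/
def JSQ.matRet (al : ℝ) : Matrix (Fin 2) (Fin 2) ℝ := !![0, 0; al, 0]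

/-- `A_{0,0}`. -/
def JSQ.matA00 (lam mu : ℝ) : Matrix (Fin 2) (Fin 2) ℝ := !![-lam, mu; lam, -(lam + mu)]

/-- `H`. -/
def JSQ.matH (al : ℝ) : Matrix (Fin 2) (Fin 2) ℝ := !![al, 0; 0, 0]

/-- `C_{0,0} = A_{0,0} - 2H`. -/
def JSQ.matC00 (lam mu al : ℝ) : Matrix (Fin 2) (Fin 2) ℝ :=
  JSQ.matA00 lam mu - (2 : ℝ) • JSQ.matH al

/-- The equilibrium equations of the horizontal boundary (`n = 0` and `n = 1`) and of the interior
(`n ≥ 2`), all for `m ≥ 1`. Here `q m n = (q_{m,n}(0), q_{m,n}(1))ᵀ`, where `m` is the length of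
the shorter orbit queue, `n` the difference of the two lengths, and the coordinate is the state
of the server. -/
structure JSQ.EquilibriumEqs (lam mu al : ℝ) (q : ℕ → ℕ → Fin 2 → ℝ) : Prop where
  horizontal_zero : ∀ m : ℕ, 1 ≤ m →
    JSQ.matC00 lam mu al *ᵥ q m 0 + JSQ.matRet al *ᵥ q m 1
      + JSQ.matArr lam *ᵥ q (m - 1) 1 = 0
  horizontal_one : ∀ m : ℕ, 1 ≤ m →
    JSQ.matC00 lam mu al *ᵥ q m 1 + JSQ.matRet al *ᵥ q m 2
      + ((2 : ℝ) • JSQ.matRet al) *ᵥ q (m + 1) 0 + JSQ.matArr lam *ᵥ q (m - 1) 2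
      + JSQ.matArr lam *ᵥ q m 0 = 0
  interior : ∀ m n : ℕ, 1 ≤ m → 2 ≤ n →
    JSQ.matC00 lam mu al *ᵥ q m n + JSQ.matRet al *ᵥ q m (n + 1)
      + JSQ.matArr lam *ᵥ q (m - 1) (n + 1) + JSQ.matRet al *ᵥ q (m + 1) (n - 1) = 0

/-- `q` solves the equations above and has the form `q(m,n) = ρ^{2m} u(n)` for `m > 0`, `n ≥ 0`,
where `u` is not identically zero and `∑ₙ ρ^{-2n} u_k(n)` converges for `k = 0, 1`. -/
structure JSQ.IsGeometricSolution (lam mu al : ℝ) (q : ℕ → ℕ → Fin 2 → ℝ)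
    (u : ℕ → Fin 2 → ℝ) : Prop where
  equations : JSQ.EquilibriumEqs lam mu al q
  form : ∀ m n : ℕ, 0 < m → q m n = JSQ.rho lam mu al ^ (2 * m) • u n
  nonzero : ∃ n : ℕ, u n ≠ 0
  summable : ∀ k : Fin 2, Summable fun n : ℕ => JSQ.rho lam mu al ^ (-2 * (n : ℤ)) * u n k

/-! The idle rows tie the busy component to the idle one, leaving a scalar sequence `x n = u n 0`.
With `r = ρ`, the interior equations become `(r+2) x(n+1) - 2r(r+1) x(n) + r³ x(n-1) = 0`, whose
characteristic roots are `r` and `r²/(r+2)`. The two horizontal equations remove the root `r`, so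
`x` is geometric with ratio `r²/(r+2)` from `n = 1` on, and `x 0` fixes everything. Weighting by
`r^(-2n)` turns the ratio into `1/(r+2) < 1`. The equivalence with `JSQ.GeometricRecursion` gives
both existence and uniqueness. -/

theorem JSQ.rho_pos {lam mu al : ℝ} (hlam : 0 < lam) (hmu : 0 < mu) (hal : 0 < al) :
    0 < JSQ.rho lam mu al := by
  unfold JSQ.rho
  positivity

/-- The balance of the idle states: `μ q(1) = (λ + 2α) q(0)`, and hence `λ q(1) = 2αρ q(0)`. -/
theorem JSQ.lam_mul_busy {lam mu al a b : ℝ} (hmu : 0 < mu) (hal : 0 < al)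
    (h : mu * b = (lam + 2 * al) * a) : lam * b = 2 * al * JSQ.rho lam mu al * a := by
  have hρ : 2 * al * mu * JSQ.rho lam mu al = lam * (lam + 2 * al) := by
    unfold JSQ.rho
    field_simp
  apply mul_left_cancel₀ hmu.ne'
  linear_combination lam * h - a * hρ

/-- The arrival and retrial matrices have zero first row, so the idle balance involves `v` alone.
The other two boundary and interior forms reduce to this one by merging vectors hit by the same
matrix. -/
theorem JSQ.horizontal_zero_iff (lam mu al : ℝ) (v w x : Fin 2 → ℝ) :
    JSQ.matC00 lam mu al *ᵥ v + JSQ.matRet al *ᵥ w + JSQ.matArr lam *ᵥ x = 0 ↔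
      mu * v 1 = (lam + 2 * al) * v 0 ∧
        lam * v 0 + al * w 0 + lam * x 1 = (lam + mu) * v 1 := by
  simp only [funext_iff, Fin.forall_fin_two, JSQ.matC00, JSQ.matA00, JSQ.matH, JSQ.matRet,
    JSQ.matArr, Matrix.mulVec, dotProduct, Fin.sum_univ_two, Pi.add_apply, Pi.zero_apply,
    Matrix.sub_apply, Matrix.smul_apply, Matrix.of_apply, Matrix.cons_val_zero,
    Matrix.cons_val_one, smul_eq_mul]
  constructor
  · rintro ⟨h₀, h₁⟩
    constructor <;> linarith
  · rintro ⟨h₀, h₁⟩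
    constructor <;> linarith

theorem JSQ.horizontal_one_iff (lam mu al : ℝ) (v w x y z : Fin 2 → ℝ) :
    JSQ.matC00 lam mu al *ᵥ v + JSQ.matRet al *ᵥ w + ((2 : ℝ) • JSQ.matRet al) *ᵥ x
        + JSQ.matArr lam *ᵥ y + JSQ.matArr lam *ᵥ z = 0 ↔
      mu * v 1 = (lam + 2 * al) * v 0 ∧
        lam * v 0 + al * w 0 + 2 * al * x 0 + lam * y 1 + lam * z 1 = (lam + mu) * v 1 := by
  have h : JSQ.matC00 lam mu al *ᵥ v + JSQ.matRet al *ᵥ w + ((2 : ℝ) • JSQ.matRet al) *ᵥ x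
        + JSQ.matArr lam *ᵥ y + JSQ.matArr lam *ᵥ z =
      JSQ.matC00 lam mu al *ᵥ v + JSQ.matRet al *ᵥ (w + (2 : ℝ) • x)
        + JSQ.matArr lam *ᵥ (y + z) := by
    rw [Matrix.mulVec_add, Matrix.mulVec_add, Matrix.mulVec_smul, Matrix.smul_mulVec]
    abel
  rw [h, JSQ.horizontal_zero_iff]
  simp only [Pi.add_apply, Pi.smul_apply, smul_eq_mul]
  refine and_congr_right fun _ => ?_
  constructor <;> intro h <;> linarith

theorem JSQ.interior_iff (lam mu al : ℝ) (v w x y : Fin 2 → ℝ) :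
    JSQ.matC00 lam mu al *ᵥ v + JSQ.matRet al *ᵥ w + JSQ.matArr lam *ᵥ x
        + JSQ.matRet al *ᵥ y = 0 ↔
      mu * v 1 = (lam + 2 * al) * v 0 ∧
        lam * v 0 + al * w 0 + lam * x 1 + al * y 0 = (lam + mu) * v 1 := by
  have h : JSQ.matC00 lam mu al *ᵥ v + JSQ.matRet al *ᵥ w + JSQ.matArr lam *ᵥ x
        + JSQ.matRet al *ᵥ y =
      JSQ.matC00 lam mu al *ᵥ v + JSQ.matRet al *ᵥ (w + y) + JSQ.matArr lam *ᵥ x := by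
    rw [Matrix.mulVec_add]
    abel
  rw [h, JSQ.horizontal_zero_iff]
  simp only [Pi.add_apply]
  refine and_congr_right fun _ => ?_
  constructor <;> intro h <;> linarith

/-- The one-term recursions that the equilibrium equations impose on the factor `u` of a
geometric solution. -/
structure JSQ.GeometricRecursion (lam mu al : ℝ) (u : ℕ → Fin 2 → ℝ) : Prop where
  idle : ∀ n, mu * u n 1 = (lam + 2 * al) * u n 0
  first : (JSQ.rho lam mu al + 2) * u 1 0 =
    2 * JSQ.rho lam mu al * (JSQ.rho lam mu al + 1) * u 0 0
  step : ∀ n, (JSQ.rho lam mu al + 2) * u (n + 2) 0 = JSQ.rho lam mu al ^ 2 * u (n + 1) 0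

/-- Put `D n = (r+2) x(n+1) - r² x(n)`. The interior equation says `D n = r * D (n-1)`, and the
horizontal equations together give `D 1 = 0`, so `D` vanishes for all `n ≥ 1`. -/
theorem JSQ.EquilibriumEqs.geometricRecursion {lam mu al : ℝ} (hlam : 0 < lam) (hmu : 0 < mu)
    (hal : 0 < al) {q : ℕ → ℕ → Fin 2 → ℝ} {u : ℕ → Fin 2 → ℝ}
    (h : JSQ.EquilibriumEqs lam mu al q)
    (hq : ∀ m n : ℕ, 0 < m → q m n = JSQ.rho lam mu al ^ (2 * m) • u n) :
    JSQ.GeometricRecursion lam mu al u := by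
  have hρ := JSQ.rho_pos hlam hmu hal
  -- The row `m = 1` would involve `q 0 n`, on which the product form says nothing; `m = 2` avoids
  -- it.
  have e₀ := (JSQ.horizontal_zero_iff _ _ _ _ _ _).1 (h.horizontal_zero 2 (by norm_num))
  have e₁ := (JSQ.horizontal_one_iff _ _ _ _ _ _ _ _).1 (h.horizontal_one 2 (by norm_num))
  have e₂ := fun n : ℕ => (JSQ.interior_iff _ _ _ _ _ _ _).1
    (h.interior 2 (n + 2) (by norm_num) (by omega))
  have hadd (n : ℕ) : n + 2 - 1 = n + 1 := rfl
  simp only [hadd, hq 1 _ (by norm_num),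
    hq 2 _ (by norm_num), hq (2 + 1) _ (by norm_num), Pi.smul_apply, smul_eq_mul] at e₀ e₁ e₂
  have idle : ∀ n, mu * u n 1 = (lam + 2 * al) * u n 0 := by
    intro n
    apply mul_left_cancel₀ (pow_pos hρ (2 * 2)).ne'
    match n with
    | 0 => linear_combination e₀.1
    | 1 => linear_combination e₁.1
    | n + 2 => linear_combination (e₂ n).1
  have busy := fun n => JSQ.lam_mul_busy hmu hal (idle n)
  set r := JSQ.rho lam mu al
  have first : (r + 2) * u 1 0 = 2 * r * (r + 1) * u 0 0 := by
    apply mul_left_cancel₀ (mul_pos hal (pow_pos hρ 3)).ne'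
    linear_combination e₀.2 - r ^ 2 * busy 1 + r ^ 4 * (busy 0 + idle 0)
  refine ⟨idle, first, fun n => ?_⟩
  induction n with
  | zero =>
    apply mul_left_cancel₀ (mul_pos hal (pow_pos hρ 3)).ne'
    linear_combination e₁.2 - r ^ 2 * busy 2 + r ^ 4 * (busy 1 + idle 1) - r ^ 4 * busy 0
      + al * r ^ 4 * first
  | succ n ih =>
    apply mul_left_cancel₀ (mul_pos hal (pow_pos hρ 3)).ne'
    linear_combination (e₂ n).2 - r ^ 2 * busy (n + 3) + r ^ 4 * (busy (n + 2) + idle (n + 2))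
      + al * r ^ 4 * ih

/-- Extending the product form to `m = 0` makes the equations at `m = 1` hold by the same
computation as the others. -/
theorem JSQ.GeometricRecursion.equilibriumEqs {lam mu al : ℝ} (hlam : 0 < lam) (hmu : 0 < mu)
    (hal : 0 < al) {u : ℕ → Fin 2 → ℝ} (h : JSQ.GeometricRecursion lam mu al u) :
    JSQ.EquilibriumEqs lam mu al fun m n => JSQ.rho lam mu al ^ (2 * m) • u n := by
  have hρ := JSQ.rho_pos hlam hmu hal
  have busy := fun n => JSQ.lam_mul_busy hmu hal (h.idle n)
  obtain ⟨idle, first, step⟩ := h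
  set r := JSQ.rho lam mu al
  have hpow (m : ℕ) : r ^ (2 * (m + 1)) = r ^ 2 * r ^ (2 * m) := by ring
  refine ⟨fun m hm => ?_, fun m hm => ?_, fun m n hm hn => ?_⟩
  · obtain ⟨m, rfl⟩ := Nat.exists_eq_add_of_le' hm
    rw [JSQ.horizontal_zero_iff]
    simp only [Nat.add_one_sub_one, Pi.smul_apply, smul_eq_mul, hpow]
    set p := r ^ (2 * m)
    constructor
    · linear_combination r ^ 2 * p * idle 0
    · linear_combination p * busy 1 - r ^ 2 * p * (busy 0 + idle 0) + al * r * p * first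
  · obtain ⟨m, rfl⟩ := Nat.exists_eq_add_of_le' hm
    rw [JSQ.horizontal_one_iff]
    simp only [Nat.add_one_sub_one, Pi.smul_apply, smul_eq_mul, hpow]
    set p := r ^ (2 * m)
    constructor
    · linear_combination r ^ 2 * p * idle 1
    · linear_combination p * busy 2 - r ^ 2 * p * (busy 1 + idle 1) + r ^ 2 * p * busy 0
        + al * r * p * step 0 - al * r ^ 2 * p * first
  · obtain ⟨m, rfl⟩ := Nat.exists_eq_add_of_le' hm
    obtain ⟨n, rfl⟩ := Nat.exists_eq_add_of_le' hn
    have hadd : n + 2 - 1 = n + 1 := rfl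
    rw [JSQ.interior_iff]
    simp only [Nat.add_one_sub_one, hadd, Pi.smul_apply, smul_eq_mul, hpow]
    set p := r ^ (2 * m)
    constructor
    · linear_combination r ^ 2 * p * idle (n + 2)
    · linear_combination p * busy (n + 3) - r ^ 2 * p * (busy (n + 2) + idle (n + 2))
        + al * r * p * step (n + 1) - al * r ^ 2 * p * step n

/-- The idle component of the explicit solution. -/
noncomputable def JSQ.idleFactor (r : ℝ) : ℕ → ℝ
  | 0 => (r + 2) / (2 * (r + 1))
  | n + 1 => r * (r ^ 2 / (r + 2)) ^ n

theorem JSQ.idleFactor_pos {r : ℝ} (hr : 0 < r) (n : ℕ) : 0 < JSQ.idleFactor r n := by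
  cases n <;> · unfold JSQ.idleFactor; positivity

theorem JSQ.summable_idleFactor {r : ℝ} (hr : 0 < r) :
    Summable fun n : ℕ => r ^ (-2 * (n : ℤ)) * JSQ.idleFactor r n := by
  -- The exceptional term `n = 0` is dropped; the rest is `r⁻¹ (1/(r+2))^n`.
  rw [← summable_nat_add_iff 1]
  have hlt : 1 / (r + 2) < 1 := by
    rw [div_lt_one (by positivity)]
    linarith
  refine ((summable_geometric_of_lt_one (by positivity) hlt).mul_left r⁻¹).congr fun n => ?_
  have hz : r ^ (-2 * ((n + 1 : ℕ) : ℤ)) = ((r ^ 2) ^ (n + 1))⁻¹ := by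
    rw [← pow_mul, ← zpow_natCast, ← zpow_neg]
    congr 1
  rw [hz, JSQ.idleFactor, div_pow, div_pow, one_pow]
  field_simp
  ring

/-- The explicit factor `u` of the geometric solution. -/
noncomputable def JSQ.geometricFactor (lam mu al : ℝ) (n : ℕ) : Fin 2 → ℝ :=
  JSQ.idleFactor (JSQ.rho lam mu al) n • ![1, (lam + 2 * al) / mu]

theorem JSQ.geometricRecursion_geometricFactor {lam mu al : ℝ} (hlam : 0 < lam) (hmu : 0 < mu)
    (hal : 0 < al) : JSQ.GeometricRecursion lam mu al (JSQ.geometricFactor lam mu al) := by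
  have hρ := JSQ.rho_pos hlam hmu hal
  refine ⟨fun n => ?_, ?_, fun n => ?_⟩ <;>
    simp only [JSQ.geometricFactor, Pi.smul_apply, smul_eq_mul, Matrix.cons_val_zero,
      Matrix.cons_val_one, JSQ.idleFactor, pow_zero, mul_one]
  · field_simp
  · field_simp
  · rw [pow_succ]
    field_simp

theorem JSQ.GeometricRecursion.eq_smul {lam mu al : ℝ} (hlam : 0 < lam) (hmu : 0 < mu)
    (hal : 0 < al) {u v : ℕ → Fin 2 → ℝ} (hu : JSQ.GeometricRecursion lam mu al u)
    (hv : JSQ.GeometricRecursion lam mu al v) {c : ℝ} (h₀ : v 0 0 = c * u 0 0) (n : ℕ) :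
    v n = c • u n := by
  have hρ : JSQ.rho lam mu al + 2 ≠ 0 := by
    have := JSQ.rho_pos hlam hmu hal
    positivity
  have h₁ (n : ℕ) : v (n + 1) 0 = c * u (n + 1) 0 := by
    apply mul_left_cancel₀ hρ
    induction n with
    | zero =>
      rw [hv.first, h₀]
      linear_combination -c * hu.first
    | succ n ih =>
      rw [hv.step, mul_left_cancel₀ hρ ih]
      linear_combination -c * hu.step n
  have h (n : ℕ) : v n 0 = c * u n 0 := by
    cases n
    · exact h₀
    · exact h₁ _
  ext k
  match k with
  | 0 => exact h n
  | 1 =>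
    rw [Pi.smul_apply, smul_eq_mul]
    apply mul_left_cancel₀ hmu.ne'
    rw [hv.idle, h]
    linear_combination -c * hu.idle n

theorem JSQ.isGeometricSolution_geometricFactor {lam mu al : ℝ} (hlam : 0 < lam) (hmu : 0 < mu)
    (hal : 0 < al) :
    JSQ.IsGeometricSolution lam mu al
      (fun m n => JSQ.rho lam mu al ^ (2 * m) • JSQ.geometricFactor lam mu al n)
      (JSQ.geometricFactor lam mu al) := by
  have hρ := JSQ.rho_pos hlam hmu hal
  refine ⟨(JSQ.geometricRecursion_geometricFactor hlam hmu hal).equilibriumEqs hlam hmu hal,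
    fun _ _ _ => rfl, ⟨0, fun h => ?_⟩, fun k => ?_⟩
  · have := congrFun h 0
    simp [JSQ.geometricFactor, (JSQ.idleFactor_pos hρ 0).ne'] at this
  · simp only [JSQ.geometricFactor, Pi.smul_apply, smul_eq_mul, ← mul_assoc]
    exact (JSQ.summable_idleFactor hρ).mul_right _

theorem lemma1 (lam mu al : ℝ) (hlam : 0 < lam) (hmu : 0 < mu) (hal : 0 < al)
    (hrho : JSQ.rho lam mu al < 1) :
    ∃ (q : ℕ → ℕ → Fin 2 → ℝ) (u : ℕ → Fin 2 → ℝ),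
      JSQ.IsGeometricSolution lam mu al q u ∧
      (∀ n : ℕ, u n ≠ 0) ∧
      (∀ n : ℕ, q 0 n = u n) ∧
      ∀ (q' : ℕ → ℕ → Fin 2 → ℝ) (u' : ℕ → Fin 2 → ℝ),
        JSQ.IsGeometricSolution lam mu al q' u' →
        ∃ c : ℝ, c ≠ 0 ∧ (∀ n : ℕ, u' n = c • u n) ∧
          ∀ m n : ℕ, 0 < m → q' m n = c • q m n := by
  have hpos (n : ℕ) : JSQ.geometricFactor lam mu al n 0 ≠ 0 := by
    simpa [JSQ.geometricFactor] using (JSQ.idleFactor_pos (JSQ.rho_pos hlam hmu hal) n).ne'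
  refine ⟨_, _, JSQ.isGeometricSolution_geometricFactor hlam hmu hal,
    fun n h => hpos n (congrFun h 0), fun n => by simp, fun q' u' h => ?_⟩
  have hu' := (JSQ.geometricRecursion_geometricFactor hlam hmu hal).eq_smul hlam hmu hal
    (h.equations.geometricRecursion hlam hmu hal h.form) (div_mul_cancel₀ (u' 0 0) (hpos 0)).symm
  refine ⟨_, fun hc => ?_, hu', fun m n hm => ?_⟩
  -- The constant is `u' 0 0 / u 0 0`; were it zero, `u'` would vanish identically.
  · obtain ⟨n, hn⟩ := h.nonzero
    exact hn (by rw [hu' n, hc, zero_smul])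
  · rw [h.form m n hm, hu' n, smul_comm]
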